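/- Let $H$ be a group, $G$ a subgroup of $H$ and $X\subseteq H$ a subset with $1\in X$. Let $\mathcal P$ be the set of all intersections of finite nonempty families of sets of the form $gX$ with $g\in G$ and $1\in gX$. Let $C$ be the set of triples $(a,P,b)$ with $a,b\in G$, $P\in\mathcal P$ and $P\subseteq aX\cap bX$, with the partial product $(a,P,b)(b,Q,c)=(a,P\cap Q,c)$ (other products being undefined). The group $G$ acts partially on $C$ by $g\cdot(a,P,b)=(ga,gP,gb)$, defined when $gP\in\mathcal P$. Let $\Gamma(X,G,H)=C/G$ be the set of classes $[x]$, where $x\sim y$ if and only if $g\cdot x=y$ for some $g\in G$, with the partial product $[x][y]=[(g\cdot x)(h\cdot y)]$, defined if there are $g,h\in G$ for which $(g\cdot x)(h\cdot y)$ is defined in $C$. The universal group of a set $S$ with a partial binary operation $\circ$ is the group with generating set $S$ and relations $s\cdot t=s\circ t$ for all $s,t\in S$ such that $s\circ t$ is defined. **Theorem.** Let $H$ be a connected and simply connected topological group and let $G$ be a dense subgroup of $H$. Let $1\in V\subseteq X\subseteq H$, where $V$ is open in $H$, path-connected, and a $G$-covering, that is, $H=\bigcup_{g\in G}gV$. Suppose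 that $X\subseteq\bigcup_{s\in V}Vs^{-1}$. Then the universal group of $\Gamma(X,G,H)$ is isomorphic to $G$. -/

import Mathlib

open scoped Pointwise

/-- A set with a partial binary operation, given by its graph: `IsMul s t u` says that the product
of `s` and `t` is defined and equal to `u`. -/
class PartialMul (S : Type*) where
  IsMul : S → S → S → Prop
  unique : ∀ {s t u v : S}, IsMul s t u → IsMul s t v → u = v

/-- The defining relators `s · t · (s ∘ t)⁻¹`, one for each defined product `s ∘ t`. -/
def universalRels (S : Type*) [PartialMul S] : Set (FreeGroup S) :=
  {r | ∃ s t u : S, PartialMul.IsMul s t u ∧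
    r = FreeGroup.of s * FreeGroup.of t * (FreeGroup.of u)⁻¹}

/-- The universal group of a set with a partial binary operation: the free group on `S` modulo
`s · t = s ∘ t` for all `s, t` such that `s ∘ t` is defined. -/
abbrev UniversalGroup (S : Type*) [PartialMul S] : Type _ :=
  PresentedGroup (universalRels S)

/-- `V ⊆ M` is a `G`-covering if the translates `gV`, `g ∈ G`, cover `M`. -/
def IsGCovering (G : Type*) {M : Type*} [Group G] [MulAction G M] (V : Set M) : Prop :=
  (⋃ g : G, g • V) = Set.univ

namespace GammaSemigroup

/-- The translates `gX`, `g ∈ G`, that contain `1`. -/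
def translates {H : Type*} [Group H] (X : Set H) (G : Subgroup H) : Set (Set H) :=
  {A | (∃ g : G, A = g • X) ∧ (1 : H) ∈ A}

/-- The intersections of finite nonempty families of translates `gX ∋ 1`, `g ∈ G`. -/
def patterns {H : Type*} [Group H] (X : Set H) (G : Subgroup H) : Set (Set H) :=
  {P | ∃ F : Set (Set H), F.Finite ∧ F.Nonempty ∧ F ⊆ translates X G ∧ P = ⋂₀ F}

theorem inter_mem_patterns {H : Type*} [Group H] {X : Set H} {G : Subgroup H} {P Q : Set H}
    (hP : P ∈ patterns X G) (hQ : Q ∈ patterns X G) : P ∩ Q ∈ patterns X G := by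
  obtain ⟨F, hF, hFn, hFt, rfl⟩ := hP
  obtain ⟨F', hF', -, hFt', rfl⟩ := hQ
  exact ⟨F ∪ F', hF.union hF', hFn.inl, Set.union_subset hFt hFt', Set.sInter_union F F' |>.symm⟩

/-- The triples `(a, P, b)` with `a, b ∈ G`, `P` a pattern, `P ⊆ aX` and `P ⊆ bX`. -/
@[ext]
structure Triple {H : Type*} [Group H] (X : Set H) (G : Subgroup H) where
  left : G
  pattern : Set H
  right : G
  mem_patterns : pattern ∈ patterns X G
  subset_left : pattern ⊆ left • X
  subset_right : pattern ⊆ right • X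

/-- The product `(a, P, b)(b, Q, c) = (a, P ∩ Q, c)`. -/
def Triple.mul {H : Type*} [Group H] {X : Set H} {G : Subgroup H} (x y : Triple X G)
    (_h : x.right = y.left) : Triple X G where
  left := x.left
  pattern := x.pattern ∩ y.pattern
  right := y.right
  mem_patterns := inter_mem_patterns x.mem_patterns y.mem_patterns
  subset_left := Set.inter_subset_left.trans x.subset_left
  subset_right := Set.inter_subset_right.trans y.subset_right

/-- The partial action `g · (a, P, b) = (ga, gP, gb)`, defined if `gP` is a pattern. -/
def Triple.act {H : Type*} [Group H] {X : Set H} {G : Subgroup H} (g : G) (x : Triple X G)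
    (h : g • x.pattern ∈ patterns X G) : Triple X G where
  left := g * x.left
  pattern := g • x.pattern
  right := g * x.right
  mem_patterns := h
  subset_left := by
    rw [mul_smul]
    exact Set.smul_set_mono x.subset_left
  subset_right := by
    rw [mul_smul]
    exact Set.smul_set_mono x.subset_right

/-- Two triples are equivalent if some element of `G` takes the one to the other. -/
def orbitSetoid {H : Type*} [Group H] (X : Set H) (G : Subgroup H) : Setoid (Triple X G) where
  r x y := ∃ (g : G) (h : g • x.pattern ∈ patterns X G), x.act g h = y
  iseqv := by
    refine ⟨fun x => ⟨1, by simpa using x.mem_patterns, ?_⟩, ?_, ?_⟩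
    · ext1 <;> simp [Triple.act]
    · rintro x _ ⟨g, h, rfl⟩
      refine ⟨g⁻¹, by simpa [Triple.act] using x.mem_patterns, ?_⟩
      ext1 <;> simp [Triple.act]
    · rintro x _ _ ⟨g, h, rfl⟩ ⟨k, h', rfl⟩
      refine ⟨k * g, by simpa [Triple.act, mul_smul] using h', ?_⟩
      ext1 <;> simp [Triple.act, mul_smul, mul_assoc]

end GammaSemigroup

/-- The underlying set of the semigroup `Γ(X, G, H)`: the classes `[a, P, b]` of triples under the
partial action of `G`. -/
def Gamma {H : Type*} [Group H] (X : Set H) (G : Subgroup H) : Type _ :=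
  Quotient (GammaSemigroup.orbitSetoid X G)

/-- The class `[a, P, b]` of a triple. -/
def Gamma.mk {H : Type*} [Group H] {X : Set H} {G : Subgroup H}
    (x : GammaSemigroup.Triple X G) : Gamma X G :=
  Quotient.mk (GammaSemigroup.orbitSetoid X G) x

/-- The partial product of `Γ(X, G, H)`: the product of two classes is defined if they have
representatives whose product is defined, and it is then the class of that product. -/
instance Gamma.instPartialMul {H : Type*} [Group H] (X : Set H) (G : Subgroup H) :
    PartialMul (Gamma X G) where
  IsMul s t u := ∃ (x y : GammaSemigroup.Triple X G) (h : x.right = y.left),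
    Gamma.mk x = s ∧ Gamma.mk y = t ∧ Gamma.mk (x.mul y h) = u
  unique := by
    rintro s t u v ⟨x, y, h, rfl, rfl, rfl⟩ ⟨x', y', h', hx, hy, rfl⟩
    obtain ⟨g, hg, rfl⟩ := Quotient.exact hx.symm
    obtain ⟨k, hk, rfl⟩ := Quotient.exact hy.symm
    have hgk : g = k := by
      have h2 : g * x.right = k * y.left := h'
      rw [h] at h2
      exact mul_right_cancel h2
    subst hgk
    refine Quotient.sound ⟨g, ?_, ?_⟩
    · show g • (x.pattern ∩ y.pattern) ∈ _
      rw [Set.smul_set_inter]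
      exact GammaSemigroup.inter_mem_patterns hg hk
    · ext1
      · rfl
      · exact Set.smul_set_inter
      · rfl

/-! ### Path lifting in coverings -/

section Covering

variable {E X : Type*} [TopologicalSpace E] [TopologicalSpace X] {p : E → X}

/-! Sending `[a, P, b]` to `a⁻¹b` gives a homomorphism from the universal group to `G`; the task is
to invert it. Idempotents `[a, P, a]` become trivial, so patterns can be shrunk and the class of
`(a, P, b)` depends only on `a⁻¹b` (`cls_eq_cls`). This yields a map `σ` (`localSection`) on `G`
with `σ(ab⁻¹)σ(bc⁻¹) = σ(ac⁻¹)` for `a, b, c ∈ G ∩ X`.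

By density of `G`, `σ` is multiplicative whenever `V ∩ gV ∩ ghV` is nonempty. Simple connectedness
then gives a homomorphism `ψ` equal to `σ` wherever `V ∩ gV` is nonempty
(`IsGCovering.exists_monoidHom`): `σ` defines a cocycle on the cover by translates `gV`, hence a
covering of `H`, which is trivial. The condition on `X` extends the equality to `G ∩ X`, and so to
every `a⁻¹b` that occurs; thus `ψ` is the inverse. -/

theorem IsCoveringMap.exists_joined [PathConnectedSpace X] (cov : IsCoveringMap p) (e : E) (x : X) :
    ∃ e' : E, p e' = x ∧ Joined e e' := by
  let γ := PathConnectedSpace.somePath (p e) x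
  let e' := cov.monodromy (.mk γ) ⟨e, rfl⟩
  exact ⟨e', e'.2, ⟨(cov.liftPathQuotient (.mk γ) ⟨e, rfl⟩).out⟩⟩

/-- The joining path projects to a null-homotopic loop, whose monodromy is trivial. -/
theorem IsCoveringMap.eq_of_joined [SimplyConnectedSpace X] (cov : IsCoveringMap p) {e e' : E}
    (h : Joined e e') (hp : p e = p e') : e = e' := by
  have h1 := cov.monodromy_eq_of_map_eq (γ := .refl (p e)) (ex := ⟨e, rfl⟩) (ey := ⟨e', hp.symm⟩)
    (.mk h.somePath) (Subsingleton.elim _ _)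
  rw [cov.monodromy_refl] at h1
  exact congrArg Subtype.val h1

end Covering

/-! ### Cocycles and coboundaries -/

section Cocycle

variable {B ι T : Type*} [TopologicalSpace B] [Group T]

/-- The bundle with discrete fibre `T` glued from a locally constant cocycle. -/
noncomputable def flatBundleCore (W : ι → Set B) (hWo : ∀ i, IsOpen (W i))
    (hWc : ∀ x, ∃ i, x ∈ W i) (φ : ι → ι → T)
    (hφ : ∀ i j k, ∀ x ∈ W i ∩ W j ∩ W k, φ j k * φ i j = φ i k) :
    letI : TopologicalSpace T := ⊥
    FiberBundleCore ι B T :=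
  letI : TopologicalSpace T := ⊥
  haveI : DiscreteTopology T := ⟨rfl⟩
  { baseSet := W
    isOpen_baseSet := hWo
    indexAt := fun x => (hWc x).choose
    mem_baseSet_at := fun x => (hWc x).choose_spec
    coordChange := fun i j _ t => φ i j * t
    coordChange_self := fun i x hx t => by
      have := hφ i i i x ⟨⟨hx, hx⟩, hx⟩
      rw [mul_eq_left.mp this, one_mul]
    continuousOn_coordChange := fun i j =>
      ((continuous_of_discreteTopology (f := fun t : T => φ i j * t)).comp
        continuous_snd).continuousOn
    coordChange_comp := fun i j k x hx t => by rw [← mul_assoc, hφ i j k x hx] }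

/-- Over a simply connected space, a locally constant cocycle on a cover by path-connected open
sets is a coboundary. -/
theorem exists_coboundary [SimplyConnectedSpace B] (W : ι → Set B) (hWo : ∀ i, IsOpen (W i))
    (hWp : ∀ i, IsPathConnected (W i)) (hWc : ∀ x, ∃ i, x ∈ W i) (φ : ι → ι → T)
    (hφ : ∀ i j k, ∀ x ∈ W i ∩ W j ∩ W k, φ j k * φ i j = φ i k) :
    ∃ c : ι → T, ∀ i j, (W i ∩ W j).Nonempty → c j = φ i j * c i := by
  let tT : TopologicalSpace T := ⊥
  have : DiscreteTopology T := ⟨rfl⟩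
  let Z : FiberBundleCore ι B T := flatBundleCore W hWo hWc φ hφ
  have cov : IsCoveringMap Z.proj := FiberBundle.isCoveringMap (F := T) (E := Z.Fiber)
  obtain ⟨b₀⟩ : Nonempty B := PathConnectedSpace.nonempty
  let e₀ : Z.TotalSpace := ⟨b₀, (1 : T)⟩
  -- The section over `W i` that is constantly `t` in chart `i`. The path component of `e₀` contains
  -- exactly one such sheet over each `W i`; its value is `c i`.
  let s : ι → T → B → Z.TotalSpace := fun i t x => (Z.localTriv i).toPartialEquiv.symm (x, t)
  have hs : ∀ i t, ContinuousOn (s i t) (W i) := fun i t =>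
    (Z.localTriv i).continuousOn_invFun.comp (by fun_prop) fun x hx => by
      rw [(Z.localTriv i).target_eq]; exact ⟨hx, trivial⟩
  have key : ∀ i, ∃ t, ∀ x ∈ W i, Joined e₀ (s i t x) := by
    intro i
    obtain ⟨x₀, hx₀⟩ := (hWp i).nonempty
    obtain ⟨e, he, hj⟩ := cov.exists_joined e₀ x₀
    have hei : e ∈ (Z.localTriv i).source := by
      rw [(Z.localTriv i).source_eq]; show Z.proj e ∈ W i; rwa [he]
    refine ⟨(Z.localTriv i e).2, fun x hx => hj.trans ?_⟩
    have h1 : s i (Z.localTriv i e).2 x₀ = e := by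
      have h2 := (Z.localTriv i).toPartialEquiv.left_inv hei
      rw [← he]
      exact h2
    have h3 := ((hWp i).image' (hs i (Z.localTriv i e).2)).joinedIn _ ⟨x₀, hx₀, rfl⟩ _
      ⟨x, hx, rfl⟩
    rw [h1] at h3
    exact h3.joined
  choose c hc using key
  refine ⟨c, fun i j => ?_⟩
  rintro ⟨x, hxi, hxj⟩
  have h := cov.eq_of_joined ((hc i x hxi).symm.trans (hc j x hxj)) rfl
  -- Both sheets meet the fibre over `x` in one point, read here in the preferred chart at `x`.
  have h1 : φ i (Z.indexAt x) * c i = φ j (Z.indexAt x) * c j :=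
    eq_of_heq (Bundle.TotalSpace.mk.inj h).2
  have hx := Z.mem_baseSet_at x
  have h2 := hφ i j (Z.indexAt x) x ⟨⟨hxi, hxj⟩, hx⟩
  rw [← h2, mul_assoc] at h1
  exact (mul_left_cancel h1).symm

/-- A function on the index set of an open cover of a connected space is constant if it takes the
same value at indices of overlapping sets. -/
theorem eq_of_overlap {S : Type*} [PreconnectedSpace B] (W : ι → Set B) (hWo : ∀ i, IsOpen (W i))
    (hWc : ∀ x, ∃ i, x ∈ W i) (f : ι → S) (hf : ∀ i j, (W i ∩ W j).Nonempty → f i = f j)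
    (i j : ι) (hi : (W i).Nonempty) (hj : (W j).Nonempty) : f i = f j := by
  choose k hk using hWc
  have hloc : IsLocallyConstant fun x => f (k x) := by
    refine (IsLocallyConstant.iff_exists_open _).mpr fun x => ⟨W (k x), hWo _, hk x, fun y hy => ?_⟩
    exact hf _ _ ⟨y, hk y, hy⟩
  obtain ⟨x, hx⟩ := hi
  obtain ⟨y, hy⟩ := hj
  rw [hf i (k x) ⟨x, hx, hk x⟩, hf j (k y) ⟨y, hy, hk y⟩]
  exact hloc.apply_eq_of_preconnectedSpace x y

end Cocycle

/-! ### Extending local homomorphisms -/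

section LocalHom

variable {H : Type*} [TopologicalSpace H] [Group H] [IsTopologicalGroup H] {G : Subgroup H}
  {V : Set H}

theorem IsGCovering.exists_mem {M G : Type*} [Group G] [MulAction G M] {V : Set M}
    (h : IsGCovering G V) (x : M) : ∃ g : G, x ∈ g • V :=
  Set.mem_iUnion.mp (h ▸ Set.mem_univ x)

/-- Homomorphisms on `G` are determined by their values on the `g` with `V ∩ gV ≠ ∅`. -/
theorem IsGCovering.monoidHom_ext [PreconnectedSpace H] (hVc : IsGCovering G V) (hVo : IsOpen V)
    (hV : V.Nonempty) {M : Type*} [Group M] {ψ ψ' : G →* M}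
    (h : ∀ g : G, (V ∩ g • V).Nonempty → ψ g = ψ' g) : ψ = ψ' := by
  ext g
  have := eq_of_overlap (fun g : G => g • V) (fun g => hVo.smul g) hVc.exists_mem
    (fun g => ψ g * (ψ' g)⁻¹) (fun i j hij => ?_) g 1 hV.smul_set hV.smul_set
  · simpa [mul_inv_eq_one] using this
  · have h1 : (V ∩ (i⁻¹ * j) • V).Nonempty := by
      have := hij.smul_set (a := i⁻¹)
      rwa [Set.smul_set_inter, smul_smul, smul_smul, inv_mul_cancel, one_smul] at this
    have h2 := h _ h1
    show ψ i * (ψ' i)⁻¹ = ψ j * (ψ' j)⁻¹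
    rw [map_mul, map_mul, map_inv, map_inv, inv_mul_eq_iff_eq_mul] at h2
    rw [h2]
    group

/-- A local homomorphism on `G` extends to a homomorphism. -/
theorem IsGCovering.exists_monoidHom [SimplyConnectedSpace H] (hVc : IsGCovering G V)
    (hVo : IsOpen V) (hVp : IsPathConnected V) {U : Type*} [Group U] (φ : G → U)
    (hφ : ∀ g h : G, (V ∩ g • V ∩ (g * h) • V).Nonempty → φ g * φ h = φ (g * h)) :
    ∃ ψ : G →* U, ∀ g : G, (V ∩ g • V).Nonempty → ψ g = φ g := by
  obtain ⟨c, hc⟩ := exists_coboundary (fun g : G => g • V) (fun g => hVo.smul g)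
    (fun g => hVp.image (f := fun x => g • x) (continuous_const_smul g)) hVc.exists_mem
    (fun g g' => φ (g'⁻¹ * g)) (by
      rintro i j k x ⟨⟨hi, hj⟩, hk⟩
      have h1 : k⁻¹ * i = (k⁻¹ * j) * (j⁻¹ * i) := by group
      show φ (k⁻¹ * j) * φ (j⁻¹ * i) = φ (k⁻¹ * i)
      rw [h1]
      refine hφ _ _ ⟨k⁻¹ • x, ⟨?_, ?_⟩, ?_⟩
      · rwa [← Set.mem_smul_set_iff_inv_smul_mem]
      · rw [mul_smul]; exact Set.smul_mem_smul_set hj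
      · rw [← h1, mul_smul]; exact Set.smul_mem_smul_set hi)
  -- The cocycle is invariant under left translation, so the left side agrees on overlapping
  -- translates. Hence `g ↦ c g * (c 1)⁻¹` reverses products, which is why `g⁻¹` appears in the
  -- homomorphism below.
  have hmul : ∀ h g : G, (c g)⁻¹ * c (h * g) = (c 1)⁻¹ * c h := by
    intro h g
    have := eq_of_overlap (fun g : G => g • V) (fun g => hVo.smul g) hVc.exists_mem
      (fun g => (c g)⁻¹ * c (h * g)) (fun i j hij => ?_) g 1 hVp.nonempty.smul_set
      hVp.nonempty.smul_set
    · simpa using this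
    · have h1 : ((h * i) • V ∩ (h * j) • V).Nonempty := by
        simpa only [Set.smul_set_inter, ← mul_smul] using hij.smul_set (a := h)
      have h2 := hc _ _ hij
      have h3 := hc _ _ h1
      have h4 : (h * j)⁻¹ * (h * i) = j⁻¹ * i := by group
      simp only [h4] at h3
      show (c i)⁻¹ * c (h * i) = (c j)⁻¹ * c (h * j)
      rw [h2, h3]
      group
  refine ⟨MonoidHom.mk' (fun g => c g⁻¹ * (c 1)⁻¹) fun g h => ?_, fun g hg => ?_⟩
  · have := hmul h⁻¹ g⁻¹
    rw [← mul_inv_rev, inv_mul_eq_iff_eq_mul] at this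
    rw [this]
    group
  · have h1 : ((1 : G) • V ∩ g⁻¹ • V).Nonempty := by
      have := hg.smul_set (a := g⁻¹)
      rw [Set.smul_set_inter, smul_smul, inv_mul_cancel, Set.inter_comm] at this
      exact this
    have h2 := hc _ _ h1
    show c g⁻¹ * (c 1)⁻¹ = φ g
    rw [h2]
    simp

end LocalHom

namespace UniversalGroup

variable {S : Type*} [PartialMul S]

/-- The canonical map to the universal group. -/
def of (s : S) : UniversalGroup S := PresentedGroup.of s

theorem of_mul {s t u : S} (h : PartialMul.IsMul s t u) : of s * of t = of u := by
  have : (PresentedGroup.mk (universalRels S))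
      (FreeGroup.of s * FreeGroup.of t * (FreeGroup.of u)⁻¹) = 1 :=
    PresentedGroup.one_of_mem ⟨s, t, u, h, rfl⟩
  rw [map_mul, map_mul, map_inv, mul_inv_eq_one] at this
  exact this

/-- The universal property of the universal group. -/
def lift {K : Type*} [Group K] (f : S → K)
    (hf : ∀ s t u, PartialMul.IsMul s t u → f s * f t = f u) : UniversalGroup S →* K :=
  PresentedGroup.toGroup (f := f) (by
    rintro _ ⟨s, t, u, h, rfl⟩
    simp [hf s t u h])

@[simp]
theorem lift_of {K : Type*} [Group K] (f : S → K)
    (hf : ∀ s t u, PartialMul.IsMul s t u → f s * f t = f u) (s : S) :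
    lift f hf (of s) = f s :=
  PresentedGroup.toGroup.of _

theorem hom_ext {K : Type*} [Group K] {f f' : UniversalGroup S →* K}
    (h : ∀ s, f (of s) = f' (of s)) : f = f' :=
  PresentedGroup.ext h

end UniversalGroup

/-! ### Triples in the universal group -/

namespace Gamma

open GammaSemigroup

variable {H : Type*} [Group H] {X : Set H} {G : Subgroup H}

theorem one_mem_of_mem_patterns {P : Set H} (hP : P ∈ patterns X G) : (1 : H) ∈ P := by
  obtain ⟨F, -, -, hF, rfl⟩ := hP
  exact fun A hA => (hF hA).2

theorem smul_mem_patterns {a : G} (h : (1 : H) ∈ a • X) : a • X ∈ patterns X G :=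
  ⟨{a • X}, Set.finite_singleton _, Set.singleton_nonempty _,
    Set.singleton_subset_iff.mpr ⟨⟨a, rfl⟩, h⟩, by simp⟩

theorem one_mem_smul_iff {a : G} : (1 : H) ∈ a • X ↔ ((a⁻¹ : G) : H) ∈ X := by
  rw [Set.mem_smul_set_iff_inv_smul_mem, Subgroup.smul_def, smul_eq_mul, mul_one]

/-- The triple `(a, aX ∩ bX, b)`. -/
def fullTriple (a b : G) (ha : (1 : H) ∈ a • X) (hb : (1 : H) ∈ b • X) : Triple X G where
  left := a
  pattern := a • X ∩ b • X
  right := b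
  mem_patterns := inter_mem_patterns (smul_mem_patterns ha) (smul_mem_patterns hb)
  subset_left := Set.inter_subset_left
  subset_right := Set.inter_subset_right

/-- The class of a triple in the universal group. -/
def cls (x : Triple X G) : UniversalGroup (Gamma X G) := UniversalGroup.of (Gamma.mk x)

theorem cls_mul (x y : Triple X G) (h : x.right = y.left) : cls x * cls y = cls (x.mul y h) :=
  UniversalGroup.of_mul ⟨x, y, h, rfl, rfl, rfl⟩

theorem cls_act (g : G) (x : Triple X G) (h : g • x.pattern ∈ patterns X G) :
    cls (x.act g h) = cls x :=
  congrArg UniversalGroup.of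
    (Quotient.sound (s := orbitSetoid X G) (a := x) (b := x.act g h) ⟨g, h, rfl⟩).symm

theorem cls_eq_one (x : Triple X G) (h : x.left = x.right) : cls x = 1 := by
  have h1 := cls_mul x x h.symm
  have h2 : x.mul x h.symm = x := by
    ext1
    · rfl
    · exact Set.inter_self _
    · rfl
  rw [h2] at h1
  exact mul_eq_left.mp h1

/-- Multiplying `(a, Q, b)` by `(a, P, a)`, whose class is trivial, shrinks `Q` to `P`. -/
theorem cls_eq_of_subset (x y : Triple X G) (hl : x.left = y.left) (hr : x.right = y.right)
    (h : x.pattern ⊆ y.pattern) : cls x = cls y := by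
  let e : Triple X G := ⟨x.left, x.pattern, x.left, x.mem_patterns, x.subset_left, x.subset_left⟩
  have h1 := cls_mul e y hl
  have h2 : e.mul y hl = x := by
    ext1
    · rfl
    · exact Set.inter_eq_left.mpr h
    · exact hr.symm
  rw [h2, cls_eq_one e rfl, one_mul] at h1
  exact h1.symm

theorem one_mem_left (x : Triple X G) : (1 : H) ∈ x.left • X :=
  x.subset_left (one_mem_of_mem_patterns x.mem_patterns)

theorem one_mem_right (x : Triple X G) : (1 : H) ∈ x.right • X :=
  x.subset_right (one_mem_of_mem_patterns x.mem_patterns)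

theorem cls_eq_full (x : Triple X G) :
    cls x = cls (fullTriple x.left x.right (one_mem_left x) (one_mem_right x)) :=
  cls_eq_of_subset _ _ rfl rfl (Set.subset_inter x.subset_left x.subset_right)

/-- In the universal group, the class of `(a, P, b)` depends only on `a⁻¹b`. -/
theorem cls_eq_cls (x y : Triple X G) (h : x.left⁻¹ * x.right = y.left⁻¹ * y.right) :
    cls x = cls y := by
  rw [cls_eq_full x, cls_eq_full y]
  set z := fullTriple x.left x.right (one_mem_left x) (one_mem_right x)
  set w := fullTriple y.left y.right (one_mem_left y) (one_mem_right y)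
  have hl : (y.left * x.left⁻¹) * x.left = y.left := by group
  have hr : (y.left * x.left⁻¹) * x.right = y.right := by rw [mul_assoc, h]; group
  have hp : (y.left * x.left⁻¹) • z.pattern = w.pattern := by
    show (y.left * x.left⁻¹) • (x.left • X ∩ x.right • X) = y.left • X ∩ y.right • X
    rw [Set.smul_set_inter, smul_smul, smul_smul, hl, hr]
  rw [← cls_act (y.left * x.left⁻¹) z (hp ▸ w.mem_patterns)]
  congr 1
  ext1
  exacts [hl, hp, hr]

/-- The homomorphism to `G` sending `[a, P, b]` to `a⁻¹b`. -/
def toSubgroup (X : Set H) (G : Subgroup H) : UniversalGroup (Gamma X G) →* G :=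
  UniversalGroup.lift
    (Quotient.lift (fun x : Triple X G => x.left⁻¹ * x.right) (by
      rintro x _ ⟨g, h, rfl⟩
      show x.left⁻¹ * x.right = (g * x.left)⁻¹ * (g * x.right)
      group))
    (by
      rintro _ _ _ ⟨x, y, h, rfl, rfl, rfl⟩
      show (x.left⁻¹ * x.right) * (y.left⁻¹ * y.right) = x.left⁻¹ * y.right
      rw [h]
      group)

theorem toSubgroup_cls (x : Triple X G) : toSubgroup X G (cls x) = x.left⁻¹ * x.right :=
  UniversalGroup.lift_of _ _ _

open Classical in
/-- The common class of the triples `(a, P, b)` with `a⁻¹b = g`; it is `1` if there are none. -/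
noncomputable def localSection (X : Set H) (G : Subgroup H) (g : G) : UniversalGroup (Gamma X G) :=
  if h : ∃ x : Triple X G, x.left⁻¹ * x.right = g then cls h.choose else 1

theorem localSection_eq (x : Triple X G) : localSection X G (x.left⁻¹ * x.right) = cls x := by
  have h : ∃ y : Triple X G, y.left⁻¹ * y.right = x.left⁻¹ * x.right := ⟨x, rfl⟩
  rw [localSection, dif_pos h]
  exact cls_eq_cls _ _ h.choose_spec

theorem localSection_mul {a b c : G} (ha : (a : H) ∈ X) (hb : (b : H) ∈ X) (hc : (c : H) ∈ X) :
    localSection X G (a * b⁻¹) * localSection X G (b * c⁻¹) = localSection X G (a * c⁻¹) := by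
  have key : ∀ {g : G}, (g : H) ∈ X → (1 : H) ∈ g⁻¹ • X := fun h =>
    one_mem_smul_iff.mpr (by rwa [inv_inv])
  let x := fullTriple a⁻¹ b⁻¹ (key ha) (key hb)
  let y := fullTriple b⁻¹ c⁻¹ (key hb) (key hc)
  have hx := localSection_eq x
  have hy := localSection_eq y
  have hxy := localSection_eq (x.mul y rfl)
  rw [← cls_mul x y rfl, ← hx, ← hy] at hxy
  simp only [x, y, fullTriple, Triple.mul, inv_inv] at hxy
  exact hxy.symm

theorem toSubgroup_localSection {a b : G} (ha : (a : H) ∈ X) (hb : (b : H) ∈ X) :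
    toSubgroup X G (localSection X G (a * b⁻¹)) = a * b⁻¹ := by
  have key : ∀ {g : G}, (g : H) ∈ X → (1 : H) ∈ g⁻¹ • X := fun h =>
    one_mem_smul_iff.mpr (by rwa [inv_inv])
  have hx := localSection_eq (fullTriple a⁻¹ b⁻¹ (key ha) (key hb))
  have h := toSubgroup_cls (fullTriple a⁻¹ b⁻¹ (key ha) (key hb))
  rw [← hx] at h
  simpa only [fullTriple, inv_inv] using h

end Gamma

open Gamma in
theorem theorem2p4p7 {H : Type*} [TopologicalSpace H] [Group H] [IsTopologicalGroup H]
    [SimplyConnectedSpace H] (G : Subgroup H) (hG : Dense (G : Set H)) (V X : Set H)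
    (h1 : (1 : H) ∈ V) (hVX : V ⊆ X) (hVo : IsOpen V) (hVp : IsPathConnected V)
    (hVc : IsGCovering G V) (hX : X ⊆ ⋃ s ∈ V, (fun v => v * s⁻¹) '' V) :
    Nonempty (UniversalGroup (Gamma X G) ≃* G) := by
  have mem_smul : ∀ {g x : G}, (x : H) ∈ g • V ↔ ((g⁻¹ * x : G) : H) ∈ V := fun {g x} => by
    rw [Set.mem_smul_set_iff_inv_smul_mem]; rfl
  obtain ⟨ψ, hψ⟩ := hVc.exists_monoidHom hVo hVp (localSection X G) (by
    intro g h hne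
    obtain ⟨y, ⟨⟨hx1, hx2⟩, hx3⟩, hyG⟩ := hG.inter_open_nonempty _
      ((hVo.inter (hVo.smul g)).inter (hVo.smul (g * h))) hne
    lift y to G using hyG
    -- Here `a = y`, `b = g⁻¹y`, `c = (gh)⁻¹y`, so `ab⁻¹ = g` and `bc⁻¹ = h`.
    have := localSection_mul (hVX hx1) (hVX (mem_smul.mp hx2)) (hVX (mem_smul.mp hx3))
    convert this using 2 <;> [congr 1; congr 1; skip] <;> group)
  have hψV : ∀ v : G, (v : H) ∈ V → ψ v = localSection X G v := fun v hv =>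
    hψ v ⟨v, hv, mem_smul.mpr (by simpa using h1)⟩
  have hψX : ∀ s : G, (s : H) ∈ X → ψ s = localSection X G s := by
    intro s hs
    -- `V ∩ s⁻¹V` is open, and nonempty by `hX`, so density puts `w` in `G`. Then `σ(s)σ(w) =
    -- σ(sw)`, with `w` and `sw` in `V`, where `ψ = σ` is known.
    obtain ⟨w, hw, hwG, hsw⟩ : ∃ w ∈ V, w ∈ G ∧ (s : H) * w ∈ V := by
      obtain ⟨w, hw, hsw⟩ : ∃ w ∈ V, (s : H) * w ∈ V := by simpa using hX hs
      obtain ⟨y, ⟨hy1, hy2⟩, hyG⟩ := hG.inter_open_nonempty (V ∩ (fun y => (s : H) * y) ⁻¹' V)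
        (hVo.inter (hVo.preimage (by fun_prop))) ⟨w, hw, hsw⟩
      exact ⟨y, hy1, hyG, hy2⟩
    have h := localSection_mul (a := s * ⟨w, hwG⟩) (b := ⟨w, hwG⟩) (c := 1) (hVX hsw) (hVX hw)
      (hVX h1)
    rw [mul_inv_cancel_right, inv_one, mul_one, mul_one, ← hψV (s * ⟨w, hwG⟩) hsw, ← hψV ⟨w, hwG⟩ hw, map_mul]
      at h
    exact (mul_right_cancel h).symm
  have hψXX : ∀ s t : G, (s : H) ∈ X → (t : H) ∈ X → ψ (s * t⁻¹) = localSection X G (s * t⁻¹) := by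
    intro s t hs ht
    have h := localSection_mul (c := 1) hs ht (hVX h1)
    rw [inv_one, mul_one, mul_one, ← hψX s hs, ← hψX t ht] at h
    rw [map_mul, map_inv, ← h, mul_inv_cancel_right]
  refine ⟨MonoidHom.toMulEquiv (toSubgroup X G) ψ (UniversalGroup.hom_ext fun s => ?_)
    (hVc.monoidHom_ext hVo hVp.nonempty fun g hg => ?_)⟩
  · obtain ⟨x, rfl⟩ := Quotient.exists_rep s
    show ψ (toSubgroup X G (cls x)) = cls x
    have h := hψXX x.left⁻¹ x.right⁻¹ (one_mem_smul_iff.mp (one_mem_left x))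
      (one_mem_smul_iff.mp (one_mem_right x))
    rw [inv_inv] at h
    rw [toSubgroup_cls, h, localSection_eq]
  · show toSubgroup X G (ψ g) = g
    rw [hψ g hg]
    obtain ⟨x, ⟨hx1, hx2⟩, hxG⟩ := hG.inter_open_nonempty _ (hVo.inter (hVo.smul g)) hg
    lift x to G using hxG
    have h := toSubgroup_localSection (hVX hx1) (hVX (mem_smul.mp hx2))
    rwa [mul_inv_rev, inv_inv, mul_inv_cancel_left] at h
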